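/- Let $n\ge 0$, $N=2^n$, let $G_N=\begin{bmatrix}1&0\\1&1\end{bmatrix}^{\otimes n}\in\mathbb F_2^{N\times N}$ with rows $g_0,\dots,g_{N-1}$, and write $\mathrm w(\cdot)$ for the Hamming weight, both of binary vectors and of the $n$-bit binary expansion of an integer in $\{0,\dots,N-1\}$. For $i\in\{0,\dots,N-1\}$ let $\mathcal Q_i\subseteq\mathbb F_2^N$ be the set of messages of the universal polar coset $\mathcal P_i=\{uG_N : u\in\mathcal Q_i\}$, that is, the set of all $u=(u_0,\dots,u_{N-1})$ with $u_h=0$ for $h<i$ and $u_i=1$, and let $$\mathcal Q_{i,w_{\min}}=\{u\in\mathcal Q_i : \mathrm w(uG_N)=\mathrm w(g_i)\},\qquad \mathcal K_i=\{j : i<j<N,\ \mathrm w(g_i\oplus g_j)=\mathrm w(g_i)\}.$$ A *dichotomous binary tree* is a (finite, non-empty) rooted binary tree whose nodes have values in $\{0,1\}$, every left child having value $0$ and every right child value $1$, such that each level other than the root level $0$ is either an *einzelchild level* (no node at this level has a sibling) or a *sibling level* (every node at this level has a sibling). It is *perfect* if all its leaves are at the last level. A set $\mathcal B\subseteq\mathbb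 F_2^N$ is *represented* by such a tree if the tree has the $N$ levels $0,\dots,N-1$ and the sequences of node values along the paths from the root to the leaves are exactly the vectors in $\mathcal B$ (so that the node at level $l$ carries the bit $b_l$). **Proposition.** For every $n\ge 0$ and every $i\in\{0,\dots,N-1\}$, the set $\mathcal Q_{i,w_{\min}}$ is represented by a perfect dichotomous binary tree whose set of sibling levels is exactly $\mathcal K_i$. Moreover, $\mathcal K_i=\{j : i<j<N,\ \mathrm w(\bar i\wedge j)=1\}$, where $\bar i$ is the bitwise complement of the $n$-bit expansion of $i$ and $\wedge$ is the bitwise AND. -/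

import Mathlib

open scoped Matrix Kronecker

namespace PolarCode

/-! ### The polar transform and polar cosets, for code length `N = 2 ^ n` -/

/-- The kernel `[1 0; 1 1]` of the polar transform. -/
def kernel : Matrix (Fin 2) (Fin 2) (ZMod 2) := !![1, 0; 1, 1]

/-- The matrix `G_N`, the `n`-th Kronecker power of the kernel. The pair of indices `(a, b)` of
`kernel ⊗ₖ G` is identified with the number `a * 2 ^ n + b`, as usual for Kronecker products. -/
def polarMatrix : (n : ℕ) → Matrix (Fin (2 ^ n)) (Fin (2 ^ n)) (ZMod 2)
  | 0 => 1
  | n + 1 =>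
      let e : Fin 2 × Fin (2 ^ n) ≃ Fin (2 ^ (n + 1)) :=
        finProdFinEquiv.trans (finCongr (pow_succ' 2 n).symm)
      Matrix.reindex e e (kernel ⊗ₖ polarMatrix n)

/-- The row `g_i` of `G_N`. -/
def polarRow (n : ℕ) (i : Fin (2 ^ n)) : Fin (2 ^ n) → ZMod 2 := polarMatrix n i

/-- The messages `𝒬_i(I, T)` of the coset with index `i`, rate-profile `I` and pre-transformation
`T`: all sums `t_i + ∑_{h ∈ H} t_h` of rows of `T`, where `H ⊆ I \ {0, …, i}`. -/
def messages {n : ℕ} (i : Fin (2 ^ n)) (I : Finset (Fin (2 ^ n)))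
    (T : Matrix (Fin (2 ^ n)) (Fin (2 ^ n)) (ZMod 2)) : Set (Fin (2 ^ n) → ZMod 2) :=
  {u | ∃ H : Finset (Fin (2 ^ n)), H ⊆ I \ Finset.Iic i ∧ u = T i + ∑ h ∈ H, T h}

/-- The messages in `𝒬_i(I, T)` whose codeword `u * G_N` has Hamming weight `w`. -/
def messagesOfWeight {n : ℕ} (i : Fin (2 ^ n)) (w : ℕ) (I : Finset (Fin (2 ^ n)))
    (T : Matrix (Fin (2 ^ n)) (Fin (2 ^ n)) (ZMod 2)) : Set (Fin (2 ^ n) → ZMod 2) :=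
  {u | u ∈ messages i I T ∧ hammingNorm (u ᵥ* polarMatrix n) = w}

/-- The messages of the universal polar coset `𝒫_i` (all positions in the rate-profile, no
pre-transformation) whose codeword has the weight `w(g_i)` of the coset leader. -/
def minWeightMessages {n : ℕ} (i : Fin (2 ^ n)) : Set (Fin (2 ^ n) → ZMod 2) :=
  messagesOfWeight i (hammingNorm (polarRow n i)) Finset.univ 1

/-- The core rows `𝒦_i`: the rows after `g_i` which, individually added to `g_i`, do not change
its weight. -/
def coreRows {n : ℕ} (i : Fin (2 ^ n)) : Set (Fin (2 ^ n)) :=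
  {j | i < j ∧ hammingNorm (polarRow n i + polarRow n j) = hammingNorm (polarRow n i)}

/-- The number of ones in an `n`-bit binary expansion. -/
def binaryWeight {n : ℕ} (x : BitVec n) : ℕ :=
  (Finset.univ.filter fun l : Fin n => x.getLsb l = true).card

end PolarCode

namespace BinaryTree

/-! ### Dichotomous binary trees

`nil` stands for an absent child, so that every non-empty tree is `node a l r`, where `a` is the
value of the root; a leaf is `node a nil nil`. The root is at level `0`. `BinaryTree.height` is the
number of levels. -/

/-- The subtrees rooted at the nodes at level `k`. -/
def subtreesAt {α : Type*} : BinaryTree α → ℕ → Set (BinaryTree α)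
  | nil, _ => ∅
  | node a l r, 0 => {node a l r}
  | node _ l r, k + 1 => l.subtreesAt k ∪ r.subtreesAt k

/-- The sequences of node values along the paths from the root to a leaf. -/
def fullPaths {α : Type*} : BinaryTree α → Set (List α)
  | nil => ∅
  | node a nil nil => {[a]}
  | node a l r => List.cons a '' (l.fullPaths ∪ r.fullPaths)

/-- The einzelchild levels: the levels other than the root level at which there are nodes, none
of which has a sibling. -/
def einzelchildLevels {α : Type*} (t : BinaryTree α) : Set ℕ :=
  {k | ∃ m, k = m + 1 ∧ (t.subtreesAt k).Nonempty ∧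
    ∀ a l r, node a l r ∈ t.subtreesAt m → l = nil ∨ r = nil}

/-- The sibling levels: the levels other than the root level at which there are nodes, all of
which have a sibling. -/
def siblingLevels {α : Type*} (t : BinaryTree α) : Set ℕ :=
  {k | ∃ m, k = m + 1 ∧ (t.subtreesAt k).Nonempty ∧
    ∀ a l r, node a l r ∈ t.subtreesAt m → (l = nil ↔ r = nil)}

/-- A dichotomous binary tree: every level other than the root level is an einzelchild level or a
sibling level, left children have value `0`, and right children have value `1`. -/
structure IsDichotomous (t : BinaryTree (ZMod 2)) : Prop where
  ne_nil : t ≠ nil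
  left_value : ∀ k a b l' r' r, node a (node b l' r') r ∈ t.subtreesAt k → b = 0
  right_value : ∀ k a l b l' r', node a l (node b l' r') ∈ t.subtreesAt k → b = 1
  level : ∀ k, 1 ≤ k → k < t.height → k ∈ t.einzelchildLevels ∨ k ∈ t.siblingLevels

/-- A perfect dichotomous binary tree: moreover, all leaves are at the last level. -/
structure IsPerfectDichotomous (t : BinaryTree (ZMod 2)) : Prop extends t.IsDichotomous where
  leaf_level : ∀ k a, node a nil nil ∈ t.subtreesAt k → k + 1 = t.height

/-- The set `B` of binary vectors is represented by the tree `t` of height `N`: the full paths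
through `t` are exactly the vectors in `B`. -/
def Represents {N : ℕ} (t : BinaryTree (ZMod 2)) (B : Set (Fin N → ZMod 2)) : Prop :=
  t.height = N ∧ t.fullPaths = List.ofFn '' B

end BinaryTree

/-! The argument splits a message `u` of length `2 ^ (n + 1)` into halves `u = (u', u'')`, for which
`u * G = (u' * G + u'' * G, u'' * G)` (`lowHalf_encode`, `highHalf_encode`), and inducts on `n`.

If the index lies in the upper half, then `u' = 0` and `u''` is an arbitrary minimal message of the
shorter coset (`isMinimal_high`). If it lies in the lower half, then
`w(u' * G + u'' * G) + w(u'' * G) ≥ w(u' * G)` for the Hamming weight `w`, with equality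
exactly if the support of `u'' * G` is contained in that of `u' * G`; so `u` is
minimal exactly if `u'` is minimal and `u'' * G` is covered by `u' * G` (`isMinimal_low`). For a
given `u'` the admissible `u''` form a linear space, in which a prefix can be continued by both
bits exactly at the leading positions of the non-zero vectors. These
positions do not depend on `u'`: they are the `j` whose binary digits are dominated by those of the
index `i'` of the shorter coset (`IsMinimal.missingBits_eq_zero`,
`IsMinimal.exists_leadsAt_covers`).
As positions in `u` they have one more leading digit, which is `1` while that of the index is `0`.
Hence the branching positions of both halves together, those of `u'` coming from the induction
hypothesis, are the `j > i` with exactly one binary digit `1` where `i` has `0`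
(`branchesAt_minimal`). The same induction identifies them as the core rows (`mem_coreRows_iff`).

It remains to pass from sets to trees: a non-empty set of binary vectors with a common first bit in
which, for each coordinate, either all prefixes branch or none does, is the set of full paths
of a perfect dichotomous tree (`BinaryTree.exists_represents`). -/

namespace BinaryTree

/-! ### The tree of a set of binary vectors -/

/-- The set `S` is the set of branching coordinates of `B`: at a coordinate in `S`, each prefix of
a vector in `B` can be continued within `B` by both bits; at a coordinate outside `S`, it determines
the next bit. -/
def BranchesAt {N : ℕ} (B : Set (Fin N → ZMod 2)) (S : Set (Fin N)) : Prop :=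
  ∀ l, (l ∈ S → ∀ b ∈ B, ∃ b' ∈ B, (∀ h < l, b' h = b h) ∧ b' l ≠ b l) ∧
    (l ∉ S → ∀ b ∈ B, ∀ b' ∈ B, (∀ h < l, b' h = b h) → b' l = b l)

/-- The vectors which continue the first bit `c` to a vector in `B`. -/
def continuations {N : ℕ} (B : Set (Fin (N + 1) → ZMod 2)) (c : ZMod 2) : Set (Fin N → ZMod 2) :=
  {b | Fin.cons c b ∈ B}

theorem BranchesAt.continuations {N : ℕ} {B : Set (Fin (N + 1) → ZMod 2)} {S : Set (Fin (N + 1))}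
    (h : BranchesAt B S) (c : ZMod 2) :
    BranchesAt (BinaryTree.continuations B c) (Fin.succ ⁻¹' S) := by
  refine fun l => ⟨fun hl b hb => ?_, fun hl b hb b' hb' hbb => ?_⟩
  · obtain ⟨b', hb', heq, hne⟩ := (h l.succ).1 hl _ hb
    have h0 : b' 0 = c := by simpa using heq 0 l.succ_pos
    refine ⟨Fin.tail b', ?_, fun k hk => ?_, ?_⟩
    · change Fin.cons c (Fin.tail b') ∈ B
      rwa [← h0, Fin.cons_self_tail]
    · simpa [Fin.tail] using heq k.succ (Fin.succ_lt_succ_iff.2 hk)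
    · simpa [Fin.tail] using hne
  · have := (h l.succ).2 hl _ hb _ hb' fun k hk => by
      cases k using Fin.cases with
      | zero => rfl
      | succ k => simpa using hbb k (Fin.succ_lt_succ_iff.1 hk)
    simpa using this

theorem nonempty_iff_continuations {N : ℕ} {B : Set (Fin (N + 1) → ZMod 2)} :
    B.Nonempty ↔ (continuations B 0).Nonempty ∨ (continuations B 1).Nonempty := by
  constructor
  · rintro ⟨b, hb⟩
    have h01 : ∀ a : ZMod 2, a = 0 ∨ a = 1 := by decide
    rw [← Fin.cons_self_tail b] at hb
    rcases h01 (b 0) with h | h <;> rw [h] at hb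
    exacts [Or.inl ⟨_, hb⟩, Or.inr ⟨_, hb⟩]
  · rintro (⟨b, hb⟩ | ⟨b, hb⟩) <;> exact ⟨_, hb⟩

theorem BranchesAt.both_of_mem {N : ℕ} {B : Set (Fin (N + 1) → ZMod 2)} {S : Set (Fin (N + 1))}
    (h : BranchesAt B S) (hS : 0 ∈ S) (hB : B.Nonempty) :
    (BinaryTree.continuations B 0).Nonempty ∧ (BinaryTree.continuations B 1).Nonempty := by
  have key : ∀ c c' : ZMod 2, c ≠ c' → (BinaryTree.continuations B c).Nonempty →
      (BinaryTree.continuations B c').Nonempty := by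
    rintro c c' hc ⟨b, hb⟩
    obtain ⟨b', hb', -, hne⟩ := (h 0).1 hS _ hb
    have h2 : ∀ a c c' : ZMod 2, c ≠ c' → a ≠ c → a = c' := by decide
    refine ⟨Fin.tail b', ?_⟩
    change Fin.cons c' (Fin.tail b') ∈ B
    rwa [← h2 (b' 0) c c' hc (by simpa using hne), Fin.cons_self_tail]
  rcases nonempty_iff_continuations.1 hB with h0 | h1
  · exact ⟨h0, key 0 1 (by decide) h0⟩
  · exact ⟨key 1 0 (by decide) h1, h1⟩

theorem BranchesAt.not_both_of_notMem {N : ℕ} {B : Set (Fin (N + 1) → ZMod 2)}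
    {S : Set (Fin (N + 1))} (h : BranchesAt B S) (hS : 0 ∉ S) :
    ¬ ((BinaryTree.continuations B 0).Nonempty ∧ (BinaryTree.continuations B 1).Nonempty) := by
  rintro ⟨⟨b, hb⟩, ⟨b', hb'⟩⟩
  have := (h 0).2 hS _ hb _ hb' fun k hk => absurd hk (Fin.not_lt_zero k)
  simp at this

open Classical in
/-- The tree with root value `c` below which the full paths are the vectors in `B`; it is `nil` if
there are none. -/
noncomputable def ofSet : (N : ℕ) → ZMod 2 → Set (Fin N → ZMod 2) → BinaryTree (ZMod 2)
  | 0, c, B => if B.Nonempty then node c nil nil else nil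
  | N + 1, c, B =>
      if B.Nonempty then
        node c (ofSet N 0 (continuations B 0)) (ofSet N 1 (continuations B 1))
      else nil

theorem ofSet_eq_nil {N : ℕ} {c : ZMod 2} {B : Set (Fin N → ZMod 2)} :
    ofSet N c B = nil ↔ ¬ B.Nonempty := by
  cases N <;> simp [ofSet]

theorem value_ofSet {N : ℕ} {c a : ZMod 2} {B : Set (Fin N → ZMod 2)} {l r : BinaryTree (ZMod 2)}
    (h : node a l r = ofSet N c B) : a = c := by
  cases N <;> (simp only [ofSet] at h; split_ifs at h; cases h; rfl)

theorem height_ofSet {N : ℕ} {c : ZMod 2} {B : Set (Fin N → ZMod 2)} (hB : B.Nonempty) :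
    (ofSet N c B).height = N + 1 := by
  induction N generalizing c with
  | zero => simp [ofSet, hB]
  | succ N ih =>
    have hle : ∀ c c', (ofSet N c (continuations B c')).height ≤ N + 1 := fun c c' => by
      by_cases h : (continuations B c').Nonempty
      · rw [ih h]
      · simp [ofSet_eq_nil.2 h]
    simp only [ofSet, hB, if_true, height]
    congr 1
    refine le_antisymm (max_le (hle _ _) (hle _ _)) (le_max_iff.2 ?_)
    exact (nonempty_iff_continuations.1 hB).imp (fun h => (ih h).ge) fun h => (ih h).ge

theorem fullPaths_node {α : Type*} {a : α} {l r : BinaryTree α} (h : ¬ (l = nil ∧ r = nil)) :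
    (node a l r).fullPaths = List.cons a '' (l.fullPaths ∪ r.fullPaths) := by
  rw [fullPaths]
  rintro rfl rfl
  exact h ⟨rfl, rfl⟩

theorem fullPaths_ofSet {N : ℕ} {c : ZMod 2} {B : Set (Fin N → ZMod 2)} :
    (ofSet N c B).fullPaths = (fun b => c :: List.ofFn b) '' B := by
  induction N generalizing c with
  | zero =>
    by_cases hB : B.Nonempty
    · obtain ⟨b, hb⟩ := id hB
      have : B = {b} := Set.eq_singleton_iff_unique_mem.2 ⟨hb, fun _ _ => Subsingleton.elim _ _⟩
      simp [ofSet, fullPaths, this]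
    · simp [ofSet, fullPaths, Set.not_nonempty_iff_eq_empty.1 hB]
  | succ N ih =>
    by_cases hB : B.Nonempty
    · simp only [ofSet, hB, if_true]
      rw [fullPaths_node, ih, ih]
      · ext p
        constructor
        · rintro ⟨_, ⟨b, hb, rfl⟩ | ⟨b, hb, rfl⟩, rfl⟩
          · exact ⟨_, hb, by simp⟩
          · exact ⟨_, hb, by simp⟩
        · rintro ⟨b, hb, rfl⟩
          have h01 : ∀ a : ZMod 2, a = 0 ∨ a = 1 := by decide
          refine ⟨List.ofFn b, ?_, rfl⟩
          rw [← Fin.cons_self_tail b] at hb ⊢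
          rcases h01 (b 0) with h | h <;> rw [h] at hb ⊢
          · exact Or.inl ⟨_, hb, by simp⟩
          · exact Or.inr ⟨_, hb, by simp⟩
      · rw [ofSet_eq_nil, ofSet_eq_nil, ← not_or, not_not]
        exact nonempty_iff_continuations.1 hB
    · simp [ofSet, fullPaths, Set.not_nonempty_iff_eq_empty.1 hB]

theorem mem_subtreesAt_zero {α : Type*} {t s : BinaryTree α} (h : s ∈ t.subtreesAt 0) : s = t := by
  cases t with
  | nil => exact h.elim
  | node a l r => exact h

/-- A subtree of `ofSet N c B` at level `k` is itself of the form `ofSet (N - k) c' B'`, for the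
set `B'` of continuations in `B` of some prefix of length `k`. -/
theorem exists_of_mem_subtreesAt_ofSet {k N : ℕ} {c : ZMod 2} {B : Set (Fin N → ZMod 2)}
    {S : Set (Fin N)} (hS : BranchesAt B S) {s : BinaryTree (ZMod 2)}
    (hs : s ∈ (ofSet N c B).subtreesAt k) :
    ∃ M, ∃ hM : M + k = N, ∃ (c' : ZMod 2) (B' : Set (Fin M → ZMod 2)),
      B'.Nonempty ∧ BranchesAt B' {l | Fin.cast hM (l.addNat k) ∈ S} ∧ s = ofSet M c' B' := by
  induction k generalizing N c with
  | zero =>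
    have hB : B.Nonempty := by
      by_contra h
      rw [ofSet_eq_nil.2 h] at hs
      exact hs
    exact ⟨N, rfl, c, B, hB, hS, mem_subtreesAt_zero hs⟩
  | succ k ih =>
    by_cases hB : B.Nonempty
    · cases N with
      | zero => simp [ofSet, hB, subtreesAt] at hs
      | succ N =>
        simp only [ofSet, hB, if_true] at hs
        have step : ∀ c', s ∈ (ofSet N c' (continuations B c')).subtreesAt k → _ := fun c' h =>
          ih (hS.continuations c') h
        obtain ⟨M, hM, c', B', h1, h2, h3⟩ := hs.elim (step 0) (step 1)
        subst hM
        exact ⟨M, rfl, c', B', h1, h2, h3⟩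
    · rw [ofSet_eq_nil.2 hB] at hs
      exact hs.elim

theorem subtreesAt_nonempty {α : Type*} {t : BinaryTree α} {k : ℕ} (hk : k < t.height) :
    (t.subtreesAt k).Nonempty := by
  induction t generalizing k with
  | nil => simp at hk
  | node a l r hl hr =>
    cases k with
    | zero => exact ⟨_, rfl⟩
    | succ k =>
      simp only [height, add_lt_add_iff_right, lt_max_iff] at hk
      rcases hk with h | h
      · exact (hl h).mono Set.subset_union_left
      · exact (hr h).mono Set.subset_union_right

theorem lt_height_of_nonempty {α : Type*} {t : BinaryTree α} {k : ℕ}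
    (h : (t.subtreesAt k).Nonempty) : k < t.height := by
  induction t generalizing k with
  | nil => exact absurd h (by simp [subtreesAt])
  | node a l r hl hr =>
    cases k with
    | zero => simp
    | succ k =>
      simp only [height, add_lt_add_iff_right, lt_max_iff]
      rcases Set.union_nonempty.1 h with h | h
      exacts [Or.inl (hl h), Or.inr (hr h)]

/-- The children of a node at level `k` of `ofSet N c B`, where `k < N`. -/
theorem children_of_mem_subtreesAt_ofSet {k N : ℕ} {c a : ZMod 2} {B : Set (Fin N → ZMod 2)}
    {S : Set (Fin N)} (hS : BranchesAt B S) (hk : k < N) {l r : BinaryTree (ZMod 2)}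
    (hs : node a l r ∈ (ofSet N c B).subtreesAt k) :
    (⟨k, hk⟩ ∈ S → l ≠ nil ∧ r ≠ nil) ∧ (⟨k, hk⟩ ∉ S → (l = nil ↔ r ≠ nil)) := by
  obtain ⟨M, rfl, c', B', hB, hS', h⟩ := exists_of_mem_subtreesAt_ofSet hS hs
  obtain ⟨M, rfl⟩ : ∃ m, M = m + 1 := ⟨M - 1, by omega⟩
  simp only [ofSet, hB, if_true] at h
  cases h
  have h0 : (0 ∈ {l : Fin (M + 1) | Fin.cast rfl (l.addNat k) ∈ S}) ↔ ⟨k, hk⟩ ∈ S := by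
    have : (Fin.cast rfl ((0 : Fin (M + 1)).addNat k) : Fin (M + 1 + k)) = ⟨k, hk⟩ := by
      ext; simp
    rw [Set.mem_ofPred_eq, this]
  rw [← h0, ne_eq, ne_eq, ofSet_eq_nil, ofSet_eq_nil, not_not, not_not]
  refine ⟨fun h => hS'.both_of_mem h hB, fun h => ?_⟩
  have := hS'.not_both_of_notMem h
  have := nonempty_iff_continuations.1 hB
  tauto

/-- A non-empty set of binary vectors which all have the same first bit, and whose prefixes of each
given length either all branch or all do not, is represented by a perfect dichotomous tree. -/
theorem exists_represents {N : ℕ} {B : Set (Fin N → ZMod 2)} {S : Set (Fin N)}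
    (hB : B.Nonempty) (hS : BranchesAt B S) (hN : 0 < N) (h0 : ⟨0, hN⟩ ∉ S) :
    ∃ t : BinaryTree (ZMod 2),
      t.IsPerfectDichotomous ∧ t.Represents B ∧ t.siblingLevels = Fin.val '' S := by
  obtain ⟨N, rfl⟩ : ∃ m, N = m + 1 := ⟨N - 1, by omega⟩
  obtain ⟨b₀, hb₀⟩ := hB
  have hfirst : ∀ b ∈ B, b 0 = b₀ 0 := fun b hb =>
    (hS 0).2 h0 _ hb₀ _ hb fun k hk => absurd hk (Fin.not_lt_zero k)
  set c := b₀ 0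
  set B' := continuations B c
  have hB' : B'.Nonempty := ⟨Fin.tail b₀, by
    change Fin.cons (b₀ 0) (Fin.tail b₀) ∈ B
    rwa [Fin.cons_self_tail]⟩
  have hS' : BranchesAt B' (Fin.succ ⁻¹' S) := hS.continuations c
  have hheight := height_ofSet (c := c) hB'
  refine ⟨ofSet N c B', ?_, ⟨hheight, ?_⟩, ?_⟩
  · refine ⟨⟨by rw [ne_eq, ofSet_eq_nil, not_not]; exact hB', ?_, ?_, ?_⟩, ?_⟩
    · intro k a b l' r' r hs
      obtain ⟨M, -, c', B'', -, -, h⟩ := exists_of_mem_subtreesAt_ofSet hS' hs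
      cases M <;> (simp only [ofSet] at h; split_ifs at h; injection h with _ h1 h2)
      · cases h1
      · exact value_ofSet h1
    · intro k a l b l' r' hs
      obtain ⟨M, -, c', B'', -, -, h⟩ := exists_of_mem_subtreesAt_ofSet hS' hs
      cases M <;> (simp only [ofSet] at h; split_ifs at h; injection h with _ h1 h2)
      · cases h2
      · exact value_ofSet h2
    · intro k hk1 hk
      obtain ⟨m, rfl⟩ : ∃ m, k = m + 1 := ⟨k - 1, by omega⟩
      have hm : m < N := by omega
      by_cases hmS : ⟨m, hm⟩ ∈ Fin.succ ⁻¹' S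
      · refine Or.inr ⟨m, rfl, subtreesAt_nonempty hk, fun a l r hs => ?_⟩
        have := (children_of_mem_subtreesAt_ofSet hS' hm hs).1 hmS
        tauto
      · refine Or.inl ⟨m, rfl, subtreesAt_nonempty hk, fun a l r hs => ?_⟩
        have := (children_of_mem_subtreesAt_ofSet hS' hm hs).2 hmS
        tauto
    · intro k a hs
      have hk := lt_height_of_nonempty ⟨_, hs⟩
      by_contra hne
      have hm : k < N := by omega
      have := children_of_mem_subtreesAt_ofSet hS' hm hs
      tauto
  · rw [fullPaths_ofSet]
    ext p
    constructor
    · rintro ⟨b, hb, rfl⟩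
      exact ⟨_, hb, by simp⟩
    · rintro ⟨b, hb, rfl⟩
      have hc : Fin.cons c (Fin.tail b) = b := by rw [← hfirst b hb, Fin.cons_self_tail]
      refine ⟨Fin.tail b, ?_, ?_⟩
      · change Fin.cons c (Fin.tail b) ∈ B
        rwa [hc]
      · change c :: List.ofFn (Fin.tail b) = List.ofFn b
        conv_rhs => rw [← hc]
        simp
  · ext k
    constructor
    · rintro ⟨m, rfl, hne, hch⟩
      have hk := lt_height_of_nonempty hne
      have hm : m < N := by omega
      refine ⟨Fin.succ ⟨m, hm⟩, ?_, rfl⟩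
      by_contra hmS
      obtain ⟨s, hs⟩ := subtreesAt_nonempty (t := ofSet N c B') (k := m) (by omega)
      obtain ⟨M, hM, c', B'', hB'', -, h⟩ := exists_of_mem_subtreesAt_ofSet hS' hs
      cases s with
      | nil => exact ofSet_eq_nil.1 h.symm hB''
      | node a l r =>
        have := (children_of_mem_subtreesAt_ofSet hS' hm hs).2 hmS
        have := hch _ _ _ hs
        tauto
    · rintro ⟨j, hj, rfl⟩
      cases j using Fin.cases with
      | zero => exact absurd hj h0
      | succ j =>
        refine ⟨j, rfl, subtreesAt_nonempty (by simp [hheight]), fun a l r hs => ?_⟩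
        have := (children_of_mem_subtreesAt_ofSet hS' j.2 hs).1 hj
        tauto

end BinaryTree

namespace PolarCode

/-! ### Splitting a vector of length `2 ^ (n + 1)` into its two halves -/

/-- The identification of pairs (leading bit, remaining bits) with indices which is used in
`polarMatrix`. -/
def blockEquiv (n : ℕ) : Fin 2 × Fin (2 ^ n) ≃ Fin (2 ^ (n + 1)) :=
  finProdFinEquiv.trans (finCongr (pow_succ' 2 n).symm)

/-- The index in the lower half at position `k`. -/
def low {n : ℕ} (k : Fin (2 ^ n)) : Fin (2 ^ (n + 1)) := blockEquiv n (0, k)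

/-- The index in the upper half at position `k`. -/
def high {n : ℕ} (k : Fin (2 ^ n)) : Fin (2 ^ (n + 1)) := blockEquiv n (1, k)

@[simp] theorem val_low {n : ℕ} (k : Fin (2 ^ n)) : (low k : ℕ) = k := by
  simp [low, blockEquiv, finProdFinEquiv]

@[simp] theorem val_high {n : ℕ} (k : Fin (2 ^ n)) : (high k : ℕ) = k + 2 ^ n := by
  simp [high, blockEquiv, finProdFinEquiv]

theorem low_or_high {n : ℕ} (i : Fin (2 ^ (n + 1))) : (∃ k, i = low k) ∨ ∃ k, i = high k := by
  obtain ⟨⟨a, k⟩, rfl⟩ := (blockEquiv n).surjective i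
  fin_cases a
  · exact Or.inl ⟨k, rfl⟩
  · exact Or.inr ⟨k, rfl⟩

@[simp] theorem low_lt_low {n : ℕ} {j k : Fin (2 ^ n)} : low j < low k ↔ j < k := by
  simp only [Fin.lt_def, val_low]

@[simp] theorem high_lt_high {n : ℕ} {j k : Fin (2 ^ n)} : high j < high k ↔ j < k := by
  simp only [Fin.lt_def, val_high, add_lt_add_iff_right]

@[simp] theorem low_inj {n : ℕ} {j k : Fin (2 ^ n)} : low j = low k ↔ j = k := by
  simp [low]

@[simp] theorem high_inj {n : ℕ} {j k : Fin (2 ^ n)} : high j = high k ↔ j = k := by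
  simp [high]

@[simp] theorem low_lt_high {n : ℕ} (j k : Fin (2 ^ n)) : low j < high k := by
  simp only [Fin.lt_def, val_low, val_high]
  omega

@[simp] theorem not_high_lt_low {n : ℕ} (j k : Fin (2 ^ n)) : ¬ high j < low k :=
  (low_lt_high k j).asymm

theorem forall_halves {n : ℕ} {p : Fin (2 ^ (n + 1)) → Prop} :
    (∀ k, p k) ↔ (∀ k, p (low k)) ∧ ∀ k, p (high k) := by
  refine ⟨fun h => ⟨fun k => h _, fun k => h _⟩, fun h k => ?_⟩
  obtain ⟨k, rfl⟩ | ⟨k, rfl⟩ := low_or_high k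
  exacts [h.1 k, h.2 k]

theorem sum_halves {n : ℕ} {M : Type*} [AddCommMonoid M] (f : Fin (2 ^ (n + 1)) → M) :
    ∑ k, f k = ∑ k, f (low k) + ∑ k, f (high k) := by
  rw [← (blockEquiv n).sum_comp, Fintype.sum_prod_type, Fin.sum_univ_two]
  rfl

/-- The lower half of a vector. -/
def lowHalf {n : ℕ} {α : Type*} (u : Fin (2 ^ (n + 1)) → α) : Fin (2 ^ n) → α := u ∘ low

/-- The upper half of a vector. -/
def highHalf {n : ℕ} {α : Type*} (u : Fin (2 ^ (n + 1)) → α) : Fin (2 ^ n) → α := u ∘ high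

/-- The vector with given halves. -/
def joinHalves {n : ℕ} {α : Type*} (x y : Fin (2 ^ n) → α) : Fin (2 ^ (n + 1)) → α :=
  fun k => if ((blockEquiv n).symm k).1 = 0 then x ((blockEquiv n).symm k).2
    else y ((blockEquiv n).symm k).2

@[simp] theorem joinHalves_low {n : ℕ} {α : Type*} (x y : Fin (2 ^ n) → α) (k : Fin (2 ^ n)) :
    joinHalves x y (low k) = x k := by
  simp [joinHalves, low]

@[simp] theorem joinHalves_high {n : ℕ} {α : Type*} (x y : Fin (2 ^ n) → α) (k : Fin (2 ^ n)) :
    joinHalves x y (high k) = y k := by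
  simp [joinHalves, high]

@[simp] theorem lowHalf_joinHalves {n : ℕ} {α : Type*} (x y : Fin (2 ^ n) → α) :
    lowHalf (joinHalves x y) = x := by
  ext k; simp [lowHalf]

@[simp] theorem highHalf_joinHalves {n : ℕ} {α : Type*} (x y : Fin (2 ^ n) → α) :
    highHalf (joinHalves x y) = y := by
  ext k; simp [highHalf]

theorem ext_halves {n : ℕ} {α : Type*} {u v : Fin (2 ^ (n + 1)) → α}
    (hl : lowHalf u = lowHalf v) (hh : highHalf u = highHalf v) : u = v :=
  funext <| forall_halves.2 ⟨congrFun hl, congrFun hh⟩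

theorem hammingNorm_halves {n : ℕ} (x : Fin (2 ^ (n + 1)) → ZMod 2) :
    hammingNorm x = hammingNorm (lowHalf x) + hammingNorm (highHalf x) := by
  simp only [hammingNorm, Finset.card_filter, sum_halves]
  rfl

/-! ### The encoding map -/

/-- The codeword `u * G_N` of the message `u`. -/
def encode {n : ℕ} (u : Fin (2 ^ n) → ZMod 2) : Fin (2 ^ n) → ZMod 2 := u ᵥ* polarMatrix n

theorem encode_add {n : ℕ} (u v : Fin (2 ^ n) → ZMod 2) :
    encode (u + v) = encode u + encode v :=
  Matrix.add_vecMul _ _ _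

@[simp] theorem encode_zero {n : ℕ} : encode (0 : Fin (2 ^ n) → ZMod 2) = 0 :=
  Matrix.zero_vecMul _

theorem encode_single {n : ℕ} (i : Fin (2 ^ n)) : encode (Pi.single i 1) = polarRow n i :=
  Matrix.single_one_vecMul _ _

theorem polarMatrix_blockEquiv {n : ℕ} (p q : Fin 2 × Fin (2 ^ n)) :
    polarMatrix (n + 1) (blockEquiv n p) (blockEquiv n q)
      = kernel p.1 q.1 * polarMatrix n p.2 q.2 := by
  change Matrix.reindex (blockEquiv n) (blockEquiv n) (kernel ⊗ₖ polarMatrix n) _ _ = _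
  simp [Matrix.kroneckerMap_apply]

theorem lowHalf_encode {n : ℕ} (u : Fin (2 ^ (n + 1)) → ZMod 2) :
    lowHalf (encode u) = encode (lowHalf u) + encode (highHalf u) := by
  ext k
  simp [lowHalf, highHalf, encode, Matrix.vecMul, dotProduct, sum_halves, low, high,
    polarMatrix_blockEquiv, kernel]

theorem highHalf_encode {n : ℕ} (u : Fin (2 ^ (n + 1)) → ZMod 2) :
    highHalf (encode u) = encode (highHalf u) := by
  ext k
  simp [highHalf, encode, Matrix.vecMul, dotProduct, sum_halves, low, high,
    polarMatrix_blockEquiv, kernel]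

theorem encode_injective {n : ℕ} : Function.Injective (encode (n := n)) := by
  induction n with
  | zero => intro u v h; simpa [encode, polarMatrix] using h
  | succ n ih =>
    intro u v h
    have hh : highHalf u = highHalf v := ih (by rw [← highHalf_encode, h, highHalf_encode])
    refine ext_halves (ih ?_) hh
    have := congrArg lowHalf h
    rwa [lowHalf_encode, lowHalf_encode, hh, add_left_inj] at this

theorem encode_surjective {n : ℕ} : Function.Surjective (encode (n := n)) :=
  Finite.surjective_of_injective encode_injective

/-! ### Supports of binary words -/

/-- The support of `y` is contained in the support of `x`. -/
def Covers {ι : Type*} (x y : ι → ZMod 2) : Prop := ∀ k, x k = 0 → y k = 0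

theorem Covers.add {ι : Type*} {x y z : ι → ZMod 2} (hy : Covers x y) (hz : Covers x z) :
    Covers x (y + z) :=
  fun k hk => by simp [hy k hk, hz k hk]

theorem covers_halves {n : ℕ} {x y : Fin (2 ^ (n + 1)) → ZMod 2} :
    Covers x y ↔ Covers (lowHalf x) (lowHalf y) ∧ Covers (highHalf x) (highHalf y) :=
  forall_halves

theorem hammingNorm_add_add {ι : Type*} [Fintype ι] (x y : ι → ZMod 2) :
    hammingNorm (x + y) + hammingNorm y
      = hammingNorm x + 2 * (Finset.univ.filter fun k => x k = 0 ∧ y k ≠ 0).card := by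
  simp only [hammingNorm, Finset.card_filter, Finset.mul_sum, ← Finset.sum_add_distrib]
  refine Finset.sum_congr rfl fun k _ => ?_
  have : ∀ a b : ZMod 2, ((if a + b ≠ 0 then 1 else 0) + if b ≠ 0 then 1 else 0)
      = (if a ≠ 0 then 1 else 0) + 2 * if a = 0 ∧ b ≠ 0 then 1 else 0 := by decide
  exact this (x k) (y k)

theorem hammingNorm_add_add_eq_iff {ι : Type*} [Fintype ι] {x y : ι → ZMod 2} :
    hammingNorm (x + y) + hammingNorm y = hammingNorm x ↔ Covers x y := by
  rw [hammingNorm_add_add]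
  simp [Finset.filter_eq_empty_iff, Covers]

theorem le_hammingNorm_add_add {ι : Type*} [Fintype ι] (x y : ι → ZMod 2) :
    hammingNorm x ≤ hammingNorm (x + y) + hammingNorm y := by
  rw [hammingNorm_add_add]
  exact Nat.le_add_right _ _

/-! ### Missing bits -/

/-- The number of binary digits which are `1` in `j` and `0` in `i`. -/
def missingBits {n : ℕ} (i j : Fin (2 ^ n)) : ℕ :=
  binaryWeight (~~~(BitVec.ofFin i) &&& BitVec.ofFin j)

theorem missingBits_eq_sum {n : ℕ} (i j : Fin (2 ^ n)) :
    missingBits i j = ∑ l : Fin n,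
      if !(i : ℕ).testBit l && (j : ℕ).testBit l then 1 else 0 := by
  rw [missingBits, binaryWeight, Finset.card_filter]
  simp

theorem testBit_high_castSucc {n : ℕ} (i : Fin (2 ^ n)) (l : Fin n) :
    (high i : ℕ).testBit l.castSucc = (i : ℕ).testBit l := by
  rw [val_high, add_comm]
  exact Nat.testBit_two_pow_add_gt l.2 _

theorem testBit_high_last {n : ℕ} (i : Fin (2 ^ n)) :
    (high i : ℕ).testBit (Fin.last n) = true := by
  rw [val_high, add_comm, Fin.val_last, Nat.testBit_two_pow_add_eq, Nat.testBit_lt_two_pow i.2]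
  rfl

theorem testBit_low_last {n : ℕ} (i : Fin (2 ^ n)) :
    (low i : ℕ).testBit (Fin.last n) = false := by
  rw [val_low, Fin.val_last, Nat.testBit_lt_two_pow i.2]

@[simp] theorem missingBits_low_low {n : ℕ} (i j : Fin (2 ^ n)) :
    missingBits (low i) (low j) = missingBits i j := by
  simp only [missingBits_eq_sum, Fin.sum_univ_castSucc, testBit_low_last]
  simp

@[simp] theorem missingBits_high_high {n : ℕ} (i j : Fin (2 ^ n)) :
    missingBits (high i) (high j) = missingBits i j := by
  simp only [missingBits_eq_sum, Fin.sum_univ_castSucc, testBit_high_last, testBit_high_castSucc]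
  simp

@[simp] theorem missingBits_high_low {n : ℕ} (i j : Fin (2 ^ n)) :
    missingBits (high i) (low j) = missingBits i j := by
  simp only [missingBits_eq_sum, Fin.sum_univ_castSucc, testBit_high_last, testBit_high_castSucc]
  simp

@[simp] theorem missingBits_low_high {n : ℕ} (i j : Fin (2 ^ n)) :
    missingBits (low i) (high j) = missingBits i j + 1 := by
  simp only [missingBits_eq_sum, Fin.sum_univ_castSucc, testBit_high_last, testBit_high_castSucc,
    testBit_low_last]
  simp


/-! ### Words of minimum weight in a coset -/

/-- The message `u` belongs to the universal polar coset with index `i`: its first non-zero entry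
is at position `i`. -/
def LeadsAt {n : ℕ} (i : Fin (2 ^ n)) (u : Fin (2 ^ n) → ZMod 2) : Prop :=
  u i = 1 ∧ ∀ h < i, u h = 0

/-- The message `u` belongs to the universal polar coset with index `i`, and its codeword has the
weight of the coset leader. -/
def IsMinimal {n : ℕ} (i : Fin (2 ^ n)) (u : Fin (2 ^ n) → ZMod 2) : Prop :=
  LeadsAt i u ∧ hammingNorm (encode u) = hammingNorm (polarRow n i)

theorem mem_messages_univ_one {n : ℕ} {i : Fin (2 ^ n)} {u : Fin (2 ^ n) → ZMod 2} :
    u ∈ messages i Finset.univ 1 ↔ LeadsAt i u := by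
  have key : ∀ H : Finset (Fin (2 ^ n)), ∀ k,
      ((1 : Matrix (Fin (2 ^ n)) (Fin (2 ^ n)) (ZMod 2)) i
        + ∑ h ∈ H, (1 : Matrix (Fin (2 ^ n)) (Fin (2 ^ n)) (ZMod 2)) h) k
      = (if i = k then 1 else 0) + if k ∈ H then 1 else 0 := fun H k => by
    refine congrArg₂ (fun a b : ZMod 2 => a + b) Matrix.one_apply
      ((Finset.sum_apply k H _).trans ?_)
    simp [Matrix.one_apply]
  constructor
  · rintro ⟨H, hH, rfl⟩
    have hlt : ∀ k ∈ H, i < k := fun k hk => by simpa using hH hk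
    refine ⟨?_, fun h hh => ?_⟩
    · rw [key, if_pos rfl, if_neg fun h => (hlt i h).false, add_zero]
    · rw [key, if_neg hh.ne', if_neg fun h => hh.asymm (hlt _ h), add_zero]
  · rintro ⟨h1, h0⟩
    refine ⟨Finset.univ.filter fun k => i < k ∧ u k = 1, fun k hk => by simp_all, ?_⟩
    ext k
    rw [key]
    have h01 : ∀ a : ZMod 2, a = if a = 1 then 1 else 0 := by decide
    rcases lt_trichotomy i k with hk | rfl | hk
    · simpa [hk.ne, hk] using h01 (u k)
    · simp [h1]
    · simp [hk.ne', hk.not_gt, h0 k hk]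

theorem mem_minWeightMessages {n : ℕ} {i : Fin (2 ^ n)} {u : Fin (2 ^ n) → ZMod 2} :
    u ∈ minWeightMessages i ↔ IsMinimal i u :=
  and_congr_left fun _ => mem_messages_univ_one

theorem leadsAt_single {n : ℕ} (i : Fin (2 ^ n)) : LeadsAt i (Pi.single i 1) :=
  ⟨Pi.single_eq_same _ _, fun _ hh => Pi.single_eq_of_ne hh.ne _⟩

theorem isMinimal_single {n : ℕ} (i : Fin (2 ^ n)) : IsMinimal i (Pi.single i 1) :=
  ⟨leadsAt_single i, by rw [encode_single]⟩

theorem leadsAt_low {n : ℕ} {i : Fin (2 ^ n)} {u : Fin (2 ^ (n + 1)) → ZMod 2} :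
    LeadsAt (low i) u ↔ LeadsAt i (lowHalf u) := by
  simp [LeadsAt, forall_halves, lowHalf]

theorem leadsAt_high {n : ℕ} {i : Fin (2 ^ n)} {u : Fin (2 ^ (n + 1)) → ZMod 2} :
    LeadsAt (high i) u ↔ lowHalf u = 0 ∧ LeadsAt i (highHalf u) := by
  simp only [LeadsAt, forall_halves, low_lt_high, high_lt_high, forall_const, funext_iff]
  exact and_left_comm

theorem hammingNorm_encode_halves {n : ℕ} (u : Fin (2 ^ (n + 1)) → ZMod 2) :
    hammingNorm (encode u) = hammingNorm (encode (lowHalf u) + encode (highHalf u))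
      + hammingNorm (encode (highHalf u)) := by
  rw [hammingNorm_halves, lowHalf_encode, highHalf_encode]

theorem single_low {n : ℕ} (i : Fin (2 ^ n)) :
    (Pi.single (low i) 1 : Fin (2 ^ (n + 1)) → ZMod 2) = joinHalves (Pi.single i 1) 0 := by
  refine funext (forall_halves.2 ⟨fun k => ?_, fun k => ?_⟩)
  · simp [Pi.single_apply]
  · simp [(low_lt_high i k).ne']

theorem single_high {n : ℕ} (i : Fin (2 ^ n)) :
    (Pi.single (high i) 1 : Fin (2 ^ (n + 1)) → ZMod 2) = joinHalves 0 (Pi.single i 1) := by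
  refine funext (forall_halves.2 ⟨fun k => ?_, fun k => ?_⟩)
  · simp [(low_lt_high k i).ne]
  · simp [Pi.single_apply]

theorem hammingNorm_polarRow_low {n : ℕ} (i : Fin (2 ^ n)) :
    hammingNorm (polarRow (n + 1) (low i)) = hammingNorm (polarRow n i) := by
  rw [← encode_single, hammingNorm_encode_halves, single_low]
  simp [encode_single]

theorem hammingNorm_polarRow_high {n : ℕ} (i : Fin (2 ^ n)) :
    hammingNorm (polarRow (n + 1) (high i)) = 2 * hammingNorm (polarRow n i) := by
  rw [← encode_single, hammingNorm_encode_halves, single_high]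
  simp [encode_single, two_mul]

/-- The coset leader has minimum weight in its coset. -/
theorem LeadsAt.hammingNorm_polarRow_le {n : ℕ} {i : Fin (2 ^ n)} {u : Fin (2 ^ n) → ZMod 2}
    (h : LeadsAt i u) : hammingNorm (polarRow n i) ≤ hammingNorm (encode u) := by
  induction n with
  | zero =>
    have hu : u = Pi.single i 1 := by
      ext k
      rw [Subsingleton.elim (α := Fin 1) k i, h.1, Pi.single_eq_same]
    rw [hu, encode_single]
  | succ n ih =>
    rw [hammingNorm_encode_halves]
    obtain ⟨i, rfl⟩ | ⟨i, rfl⟩ := low_or_high i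
    · rw [hammingNorm_polarRow_low]
      exact (ih (leadsAt_low.1 h)).trans (le_hammingNorm_add_add _ _)
    · obtain ⟨h0, h1⟩ := leadsAt_high.1 h
      rw [hammingNorm_polarRow_high, h0, encode_zero, zero_add, ← two_mul]
      exact Nat.mul_le_mul_left 2 (ih h1)

/-- In the coset with index `low i`, equality holds in the weight bound exactly if the lower half
of the message is minimal and its codeword covers the codeword of the upper half. -/
theorem isMinimal_low {n : ℕ} {i : Fin (2 ^ n)} {u : Fin (2 ^ (n + 1)) → ZMod 2} :
    IsMinimal (low i) u ↔
      IsMinimal i (lowHalf u) ∧ Covers (encode (lowHalf u)) (encode (highHalf u)) := by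
  rw [IsMinimal, IsMinimal, leadsAt_low, hammingNorm_encode_halves, hammingNorm_polarRow_low,
    ← hammingNorm_add_add_eq_iff, and_assoc]
  refine and_congr_right fun h => ?_
  have h1 := h.hammingNorm_polarRow_le
  have h2 := le_hammingNorm_add_add (encode (lowHalf u)) (encode (highHalf u))
  omega

theorem isMinimal_high {n : ℕ} {i : Fin (2 ^ n)} {u : Fin (2 ^ (n + 1)) → ZMod 2} :
    IsMinimal (high i) u ↔ lowHalf u = 0 ∧ IsMinimal i (highHalf u) := by
  rw [IsMinimal, IsMinimal, leadsAt_high, hammingNorm_encode_halves, hammingNorm_polarRow_high,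
    and_assoc]
  refine and_congr_right fun h => and_congr_right fun _ => ?_
  rw [h, encode_zero, zero_add]
  omega

/-! ### Words covered by a word of minimum weight -/

/-- If a minimal codeword in the coset with index `i` covers a codeword with leading position `j`,
then the binary digits of `j` are dominated by those of `i`. -/
theorem IsMinimal.missingBits_eq_zero {n : ℕ} {i j : Fin (2 ^ n)} {u v : Fin (2 ^ n) → ZMod 2}
    (hu : IsMinimal i u) (hv : LeadsAt j v) (hc : Covers (encode u) (encode v)) :
    missingBits i j = 0 := by
  induction n with
  | zero => simp [missingBits_eq_sum]
  | succ n ih =>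
    rw [covers_halves, lowHalf_encode, lowHalf_encode, highHalf_encode, highHalf_encode] at hc
    obtain ⟨hcl, hch⟩ := hc
    obtain ⟨i, rfl⟩ | ⟨i, rfl⟩ := low_or_high i
    · obtain ⟨hu, hs⟩ := isMinimal_low.1 hu
      obtain ⟨j, rfl⟩ | ⟨j, rfl⟩ := low_or_high j
      · rw [missingBits_low_low]
        refine ih hu (leadsAt_low.1 hv) fun k hk => ?_
        have h1 := hs k hk
        have h2 := hch k h1
        have h3 := hcl k (by simp [hk, h1])
        simpa [h2] using h3
      · -- The two halves of the covering word are disjoint, but those of the covered word agree.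
        obtain ⟨h0, hv⟩ := leadsAt_high.1 hv
        rw [h0, encode_zero, zero_add] at hcl
        have hz : encode (highHalf v) = encode 0 := by
          rw [encode_zero]
          ext k
          by_contra hk
          have h1 : encode (highHalf u) k ≠ 0 := fun h => hk (hch k h)
          have h2 : encode (lowHalf u) k ≠ 0 := fun h => h1 (hs k h)
          have h3 : ∀ a b : ZMod 2, a ≠ 0 → b ≠ 0 → a + b = 0 := by decide
          exact hk (hcl k (h3 _ _ h2 h1))
        have := hv.1
        rw [encode_injective hz] at this
        exact absurd this (by simp)
    · obtain ⟨h0, hu⟩ := isMinimal_high.1 hu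
      rw [h0, encode_zero, zero_add] at hcl
      obtain ⟨j, rfl⟩ | ⟨j, rfl⟩ := low_or_high j
      · rw [missingBits_high_low]
        refine ih hu (leadsAt_low.1 hv) fun k hk => ?_
        simpa [hch k hk] using hcl k hk
      · rw [missingBits_high_high]
        exact ih hu (leadsAt_high.1 hv).2 hch

/-- Conversely, each position whose binary digits are dominated by those of `i` is the leading
position of a codeword covered by a given minimal codeword. -/
theorem IsMinimal.exists_leadsAt_covers {n : ℕ} {i j : Fin (2 ^ n)} {u : Fin (2 ^ n) → ZMod 2}
    (hu : IsMinimal i u) (hij : missingBits i j = 0) :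
    ∃ v, LeadsAt j v ∧ Covers (encode u) (encode v) := by
  induction n with
  | zero =>
    obtain rfl := Subsingleton.elim (α := Fin 1) i j
    exact ⟨u, hu.1, fun _ h => h⟩
  | succ n ih =>
    simp only [covers_halves, lowHalf_encode, highHalf_encode]
    obtain ⟨i, rfl⟩ | ⟨i, rfl⟩ := low_or_high i
    · obtain ⟨hu, hs⟩ := isMinimal_low.1 hu
      obtain ⟨j, rfl⟩ | ⟨j, rfl⟩ := low_or_high j
      · rw [missingBits_low_low] at hij
        obtain ⟨a, ha, hca⟩ := ih hu hij
        -- The upper half is the restriction of the lower one to the support of the upper half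
        -- of the given word.
        obtain ⟨b, hb⟩ := encode_surjective fun k => encode a k * encode (highHalf u) k
        refine ⟨joinHalves a b, leadsAt_low.2 (by simpa using ha), ?_⟩
        rw [lowHalf_joinHalves, highHalf_joinHalves, hb]
        refine ⟨fun k hk => ?_, fun k hk => by simp [hk]⟩
        have key : ∀ x y z : ZMod 2, (x = 0 → z = 0) → x + y = 0 → z + z * y = 0 := by decide
        exact key _ _ _ (hca k) hk
      · simp at hij
    · obtain ⟨h0, hu⟩ := isMinimal_high.1 hu
      simp only [h0, encode_zero, zero_add]
      obtain ⟨j, rfl⟩ | ⟨j, rfl⟩ := low_or_high j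
      · rw [missingBits_high_low] at hij
        obtain ⟨a, ha, hca⟩ := ih hu hij
        refine ⟨joinHalves a 0, leadsAt_low.2 (by simpa using ha), ?_⟩
        simpa using ⟨hca, fun _ _ => rfl⟩
      · rw [missingBits_high_high] at hij
        obtain ⟨b, hb, hcb⟩ := ih hu hij
        refine ⟨joinHalves 0 b, leadsAt_high.2 (by simpa using hb), ?_⟩
        simpa using hcb

theorem covers_polarRow_iff {n : ℕ} {i j : Fin (2 ^ n)} :
    Covers (polarRow n i) (polarRow n j) ↔ missingBits i j = 0 := by
  refine ⟨fun h => ?_, fun h => ?_⟩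
  · rw [← encode_single, ← encode_single] at h
    exact (isMinimal_single i).missingBits_eq_zero (leadsAt_single j) h
  · induction n with
    | zero =>
      obtain rfl := Subsingleton.elim (α := Fin 1) i j
      exact fun _ h => h
    | succ n ih =>
      rw [← encode_single, ← encode_single, covers_halves]
      simp only [lowHalf_encode, highHalf_encode]
      obtain ⟨i, rfl⟩ | ⟨i, rfl⟩ := low_or_high i <;>
        obtain ⟨j, rfl⟩ | ⟨j, rfl⟩ := low_or_high j
      · rw [missingBits_low_low] at h
        simpa [single_low, encode_single] using ⟨ih h, fun _ _ => rfl⟩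
      · simp at h
      · rw [missingBits_high_low] at h
        simpa [single_low, single_high, encode_single] using ⟨ih h, fun _ _ => rfl⟩
      · rw [missingBits_high_high] at h
        simpa [single_high, encode_single] using ih h

/-! ### Core rows and branching -/

theorem mem_coreRows_iff {n : ℕ} {i j : Fin (2 ^ n)} :
    j ∈ coreRows i ↔ i < j ∧ missingBits i j = 1 := by
  refine and_congr_right fun hij => ?_
  rw [← encode_single i, ← encode_single j, ← encode_add]
  induction n with
  | zero => exact absurd (Subsingleton.elim (α := Fin 1) i j) hij.ne
  | succ n ih =>
    have hadd : ∀ u v : Fin (2 ^ (n + 1)) → ZMod 2,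
        lowHalf (u + v) = lowHalf u + lowHalf v ∧ highHalf (u + v) = highHalf u + highHalf v :=
      fun _ _ => ⟨rfl, rfl⟩
    simp only [hammingNorm_encode_halves, hadd]
    obtain ⟨i, rfl⟩ | ⟨i, rfl⟩ := low_or_high i <;>
      obtain ⟨j, rfl⟩ | ⟨j, rfl⟩ := low_or_high j
    · have := ih (low_lt_low.1 hij)
      simpa [single_low] using this
    · simpa [single_low, single_high, encode_single, covers_polarRow_iff] using
        hammingNorm_add_add_eq_iff (x := polarRow n i) (y := polarRow n j)
    · exact absurd hij (not_high_lt_low _ _)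
    · rw [missingBits_high_high, ← ih (high_lt_high.1 hij)]
      simp only [single_high, lowHalf_joinHalves, highHalf_joinHalves, encode_zero, zero_add,
        add_zero]
      omega

/-- The core rows are the branching coordinates of the set of minimal messages. The upper halves
which complete a minimal lower half form a linear space, so the branching there occurs at the
leading positions of the vectors in this space. -/
theorem branchesAt_minimal {n : ℕ} (i : Fin (2 ^ n)) :
    BinaryTree.BranchesAt {u | IsMinimal i u} {j | i < j ∧ missingBits i j = 1} := by
  induction n with
  | zero =>
    refine fun l => ⟨fun h => absurd (Subsingleton.elim (α := Fin 1) i l) h.1.ne,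
      fun _ b hb b' hb' _ => ?_⟩
    obtain rfl := Subsingleton.elim (α := Fin 1) i l
    rw [hb.1.1, hb'.1.1]
  | succ n ih =>
    obtain ⟨i, rfl⟩ | ⟨i, rfl⟩ := low_or_high i
    · refine forall_halves.2 ⟨fun l => ?_, fun l => ?_⟩
      · simp only [Set.mem_ofPred_eq, low_lt_low, missingBits_low_low, isMinimal_low,
          forall_halves, not_high_lt_low, false_implies, forall_const, and_true]
        refine ⟨fun hl b hb => ?_, fun hl b hb b' hb' hbb => ?_⟩
        · obtain ⟨x, hx, hxb, hne⟩ := (ih i l).1 hl _ hb.1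
          exact ⟨joinHalves x 0, by simpa using ⟨hx, fun _ _ => rfl⟩, by simpa [lowHalf] using hxb,
            by simpa [lowHalf] using hne⟩
        · exact (ih i l).2 hl _ hb.1 _ hb'.1 hbb
      · simp only [Set.mem_ofPred_eq, low_lt_high, missingBits_low_high, isMinimal_low,
          forall_halves, high_lt_high, true_and, Nat.add_eq_right, forall_const]
        refine ⟨fun hl b hb => ?_, fun hl b hb b' hb' hbb => ?_⟩
        · obtain ⟨v, hv, hcv⟩ := hb.1.exists_leadsAt_covers hl
          refine ⟨joinHalves (lowHalf b) (highHalf b + v), ?_, ⟨fun k => ?_, fun k hk => ?_⟩, ?_⟩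
          · rw [lowHalf_joinHalves, highHalf_joinHalves, encode_add]
            exact ⟨hb.1, hb.2.add hcv⟩
          · simp [lowHalf]
          · simp [highHalf, hv.2 k hk]
          · simp [highHalf, hv.1]
        · by_contra hne
          have hlow : lowHalf b' = lowHalf b := funext hbb.1
          rw [hlow] at hb'
          have hlead : LeadsAt l (highHalf b' + highHalf b) := by
            have h2 : ∀ x y : ZMod 2, x ≠ y → x + y = 1 := by decide
            refine ⟨h2 _ _ hne, fun k hk => ?_⟩
            change b' (high k) + b (high k) = 0
            rw [hbb.2 k hk, CharTwo.add_self_eq_zero]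
          refine hl (hb.1.missingBits_eq_zero hlead ?_)
          rw [encode_add]
          exact hb'.2.add hb.2
    · refine forall_halves.2 ⟨fun l => ?_, fun l => ?_⟩
      · refine ⟨fun hl => absurd hl.1 (not_high_lt_low _ _), fun _ b hb b' hb' _ => ?_⟩
        have h := (isMinimal_high.1 hb).1
        have h' := (isMinimal_high.1 hb').1
        exact (congrFun h' l).trans (congrFun h l).symm
      · simp only [Set.mem_ofPred_eq, high_lt_high, missingBits_high_high, isMinimal_high,
          forall_halves, low_lt_high, forall_const]
        refine ⟨fun hl b hb => ?_, fun hl b hb b' hb' hbb => ?_⟩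
        · obtain ⟨y, hy, hyb, hne⟩ := (ih i l).1 hl _ hb.2
          refine ⟨joinHalves 0 y, by simpa using hy, ⟨fun k => ?_, by simpa [highHalf] using hyb⟩,
            by simpa [highHalf] using hne⟩
          rw [joinHalves_low]
          exact (congrFun hb.1 k).symm
        · exact (ih i l).2 hl _ hb.2 _ hb'.2 hbb.2

end PolarCode

theorem mainTheorem5 (n : ℕ) (i : Fin (2 ^ n)) :
    (∃ t : BinaryTree (ZMod 2), t.IsPerfectDichotomous ∧
      t.Represents (PolarCode.minWeightMessages i) ∧
      t.siblingLevels = Fin.val '' PolarCode.coreRows i) ∧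
    PolarCode.coreRows i =
      {j | i < j ∧ PolarCode.binaryWeight (~~~(BitVec.ofFin i) &&& BitVec.ofFin j) = 1} := by
  have hcore : PolarCode.coreRows i = {j | i < j ∧ PolarCode.missingBits i j = 1} :=
    Set.ext fun _ => PolarCode.mem_coreRows_iff
  refine ⟨?_, hcore⟩
  have hmin : PolarCode.minWeightMessages i = {u | PolarCode.IsMinimal i u} :=
    Set.ext fun _ => PolarCode.mem_minWeightMessages
  rw [hcore, hmin]
  exact BinaryTree.exists_represents ⟨_, PolarCode.isMinimal_single i⟩
    (PolarCode.branchesAt_minimal i) (Nat.two_pow_pos n)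
    fun h => absurd h.1 (Nat.not_lt_zero _)
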